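/- Let $d\ge 2$, $q=e^{2\pi i/d}$, and label $\mathbb{Z}_d$ by $0,\dots,d-1$. Let $m,n\ge 0$. **The patch.** It has $m+1$ columns $c=0,\dots,m$ and lattice points $(c,r)$, $0\le r\le n+1$. Its edges are the upward edges $(c,r)\to(c,r+1)$ for $0\le r\le n$ and the rightward edges $(c,r)\to(c+1,r)$ for $0\le c<m$, $1\le r\le n$. So the top and bottom boundaries are rough (dangling edges) and the left and right boundaries are smooth. A face is a unit square with an edge of the patch on its border; this includes the squares just outside the left and right boundaries. Stabilisers sit at the lattice points and faces that touch at least two edges of the patch; let $V$ (so $|V|=(m+1)n$) and $P$ be the sets of these points and faces. The Hilbert space is $\mathcal H=\bigotimes_{E}\mathbb{C}\mathbb{Z}_d$, with one factor for each edge and orthonormal basis $|x\rangle$, $x\in\mathbb{Z}_d^E$. Put $X|i\rangle=|i+1\rangle$ and $Z|i\rangle=q^i|i\rangle$. **Stabilisers.** For $v\in V$ let $|l\rangle\triangleright_v$ apply $X^l$ to each edge leaving $v$ and $X^{-l}$ to each edge pointing to $v$, and let $A(v)=\frac1d\sum_{l}|l\rangle\triangleright_v$. For $p\in P$ let $B(p)$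 be the projector onto the span of those $|x\rangle$ for which the sum of the labels around $p$, with sign $+$ for edges running clockwise around $p$ and $-$ for the others, is $0$ in $\mathbb{Z}_d$. The vacuum (logical) space is $$\mathcal H_{vac}=\{\psi\in\mathcal H: A(v)\psi=\psi\ \ \forall v\in V,\quad B(p)\psi=\psi\ \ \forall p\in P\}.$$ **Strings and logical states.** Let $\xi$ be any string of faces, each step crossing an edge of the patch, from a square outside the left boundary to one outside the right boundary. ${}_xF^i_\xi$ applies, for each crossing, $X^i$ to the crossed edge if it is crossed from its left-hand to its right-hand side (with respect to its direction), and $X^{-i}$ otherwise. Let $\xi'$ be any string of lattice points, each step running along an edge of the patch, from the end of a dangling edge at the top to the end of one at the bottom. ${}_zF^{\delta_j}_{\xi'}$ is the projector onto the span of those $|x\rangle$ for which the sum of the labels along $\xi'$, with sign $-$ for edges run through against their direction, is $j$. Define $$|0\rangle_L=\prod_{v\in V}A(v)\bigotimes_E|0\rangle,\qquad |i\rangle_L={}_xF^i_\xi|0\rangle_L,\qquad |\delta_0\rangle_L=\sum_{k\in\mathbb{Z}_d}|k\rangle_L,\qquad |\delta_i\rangle_L=\sum_{j\in\mathbb{Z}_d}q^{ij}\,{}_zF^{\delta_j}_{\xi'}|\delta_0\rangle_L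 .$$ **Lemma.** $\dim\mathcal H_{vac}=d$. Moreover, for all $\xi,\xi'$ as above: 1. the states $|i\rangle_L$ do not depend on the choice of $\xi$; 2. $\{|i\rangle_L\}_{i\in\mathbb{Z}_d}$ and $\{|\delta_i\rangle_L\}_{i\in\mathbb{Z}_d}$ are bases of $\mathcal H_{vac}$. Both are orthogonal, and $\||i\rangle_L\|^2=d^{-|V|}$, $\||\delta_i\rangle_L\|^2=d\cdot d^{-|V|}$ for all $i$; 3. they are related by the logical Fourier transform: $$|\delta_i\rangle_L=\sum_{k\in\mathbb{Z}_d}q^{-ik}|k\rangle_L,\qquad |k\rangle_L=\frac1d\sum_{i\in\mathbb{Z}_d}q^{ik}|\delta_i\rangle_L ;$$ 4. up to normalisation $|\delta_0\rangle_L$ is the canonical state built from the face projectors: $\prod_{p\in P}B(p)\bigotimes_E\sum_i|i\rangle=d^{|V|}\,|\delta_0\rangle_L$. -/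

import Mathlib

/-!
The `ℂℤ_d` surface code on a rectangular patch: rough boundaries at the top and the bottom, smooth
boundaries at the left and the right.  The patch has `m + 1` columns and `n` rows of vertices that
carry stabilisers.
-/

namespace SurfaceCode

noncomputable section

/-- All end points of edges of the patch, as (column, row).  Row `0` and row `n + 1` hold the end
points of the dangling edges at the bottom and at the top. -/
abbrev Site (m n : ℕ) : Type := Fin (m + 1) × Fin (n + 2)

/-- All squares that have an edge of the patch on their border, as (column, row), counted from the
bottom left.  Column `0` and column `m + 1` hold the squares outside the patch at its left and at
its right. -/
abbrev Face (m n : ℕ) : Type := Fin (m + 2) × Fin (n + 1)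

/-- The edges of the patch. `vert c s` points upwards and `horiz c r` points to the right. -/
inductive Edge (m n : ℕ) : Type
  | vert (c : Fin (m + 1)) (s : Fin (n + 1)) : Edge m n
  | horiz (c : Fin m) (r : Fin n) : Edge m n
  deriving DecidableEq, Fintype

variable {d m n : ℕ}

/-- The site at which an edge starts. -/
def Edge.src : Edge m n → Site m n
  | .vert c s => (c, s.castSucc)
  | .horiz c r => (c.castSucc, r.castSucc.succ)

/-- The site at which an edge ends. -/
def Edge.tgt : Edge m n → Site m n
  | .vert c s => (c, s.succ)
  | .horiz c r => (c.succ, r.castSucc.succ)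

/-- The face on the left-hand side of an edge, seen along its direction. -/
def Edge.left : Edge m n → Face m n
  | .vert c s => (c.castSucc, s)
  | .horiz c r => (c.castSucc.succ, r.succ)

/-- The face on the right-hand side of an edge, seen along its direction. -/
def Edge.right : Edge m n → Face m n
  | .vert c s => (c.succ, s)
  | .horiz c r => (c.castSucc.succ, r.castSucc)

/-- The vertices that carry a stabiliser: there is none for a single edge. -/
def vertices (m n : ℕ) : Finset (Site m n) :=
  {v | 2 ≤ (Finset.univ.filter fun e : Edge m n => e.src = v ∨ e.tgt = v).card}

/-- The faces that carry a stabiliser: there is none for a single edge. -/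
def faces (m n : ℕ) : Finset (Face m n) :=
  {p | 2 ≤ (Finset.univ.filter fun e : Edge m n => e.left = p ∨ e.right = p).card}

/-- The labels `x` of the computational basis states `|x⟩ = ⊗_e |x_e⟩`. -/
abbrev Config (d m n : ℕ) : Type := Edge m n → ZMod d

/-- The Hilbert space `⊗_E ℂℤ_d`, written in its orthonormal computational basis: a vector is the
family of its amplitudes. -/
abbrev Hilb (d m n : ℕ) [NeZero d] : Type := EuclideanSpace ℂ (Config d m n)

variable [NeZero d]

/-- The computational basis state `|x⟩`. -/
def ket (x : Config d m n) : Hilb d m n := EuclideanSpace.single x 1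

/-- The product of the operators `X^(a e)` over all edges `e`; it maps `|x⟩` to `|x + a⟩`. -/
def shiftOp (a : Config d m n) : Module.End ℂ (Hilb d m n) where
  toFun ψ := WithLp.toLp 2 fun x => ψ (x - a)
  map_add' _ _ := rfl
  map_smul' _ _ := rfl

/-- The diagonal operator `|x⟩ ↦ f x • |x⟩`. -/
def diagOp (f : Config d m n → ℂ) : Module.End ℂ (Hilb d m n) where
  toFun ψ := WithLp.toLp 2 fun x => f x * ψ x
  map_add' ψ φ := by ext x; simp [mul_add]
  map_smul' c ψ := by ext x; simp [mul_left_comm]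

theorem shiftOp_ket (a x : Config d m n) : shiftOp a (ket x) = ket (x + a) := by
  ext y
  change (EuclideanSpace.single x (1 : ℂ) : Hilb d m n) (y - a) =
    (EuclideanSpace.single (x + a) (1 : ℂ) : Hilb d m n) y
  simp [sub_eq_iff_eq_add]

theorem diagOp_ket (f : Config d m n → ℂ) (x : Config d m n) :
    diagOp f (ket x) = f x • ket x := by
  ext y
  by_cases h : y = x
  · subst h; simp [diagOp, ket]
  · simp [diagOp, ket, h]

theorem shiftOp_comm (a b : Config d m n) : Commute (shiftOp a) (shiftOp b) := by
  refine LinearMap.ext fun ψ => ?_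
  ext x
  change ψ (x - a - b) = ψ (x - b - a)
  rw [sub_right_comm]

theorem diagOp_comm (f g : Config d m n → ℂ) : Commute (diagOp f) (diagOp g) := by
  refine LinearMap.ext fun ψ => ?_
  ext x
  change f x * (g x * ψ x) = g x * (f x * ψ x)
  ring

/-- The action of `|l⟩` at the site `v`: it adds `l` on the edges that leave `v` and subtracts `l`
on the edges that point towards `v`. -/
def vertexAct (l : ZMod d) (v : Site m n) : Module.End ℂ (Hilb d m n) :=
  shiftOp fun e => (if e.src = v then l else 0) - (if e.tgt = v then l else 0)

/-- The sum of the labels around the face `p`; an edge counts positively if it runs clockwise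
around `p`, that is, if `p` is on its right. -/
def flux (p : Face m n) (x : Config d m n) : ZMod d :=
  ∑ e, ((if e.right = p then x e else 0) - (if e.left = p then x e else 0))

/-- The action of `|δ_j⟩` at the face `p`. -/
def faceAct (j : ZMod d) (p : Face m n) : Module.End ℂ (Hilb d m n) :=
  diagOp fun x => if flux p x = j then 1 else 0

/-- The projector `A(v) = (1/d) ∑_l |l⟩ ▷_v`. -/
def projA (v : Site m n) : Module.End ℂ (Hilb d m n) :=
  (1 / (d : ℂ)) • ∑ l : ZMod d, vertexAct l v

/-- The projector `B(p) = |δ_0⟩ ▷_p`. -/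
def projB (p : Face m n) : Module.End ℂ (Hilb d m n) := faceAct 0 p

theorem projA_comm (v w : Site m n) :
    Commute (projA v : Module.End ℂ (Hilb d m n)) (projA w) := by
  unfold projA
  refine Commute.smul_left (Commute.smul_right ?_ _) _
  exact Commute.sum_left _ _ _ fun i _ => Commute.sum_right _ _ _ fun j _ => shiftOp_comm _ _

theorem projB_comm (p p' : Face m n) :
    Commute (projB p : Module.End ℂ (Hilb d m n)) (projB p') :=
  diagOp_comm _ _

/-- The vacuum space `H_vac`: no error is detected at any vertex or face stabiliser. -/
def vac (d m n : ℕ) [NeZero d] : Submodule ℂ (Hilb d m n) where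
  carrier := {ψ | (∀ v ∈ vertices m n, projA v ψ = ψ) ∧ ∀ p ∈ faces m n, projB p ψ = ψ}
  zero_mem' := by simp
  add_mem' := by
    rintro ψ φ ⟨h₁, h₂⟩ ⟨k₁, k₂⟩
    exact ⟨fun v hv => by rw [map_add, h₁ v hv, k₁ v hv],
      fun p hp => by rw [map_add, h₂ p hp, k₂ p hp]⟩
  smul_mem' := by
    rintro c ψ ⟨h₁, h₂⟩
    exact ⟨fun v hv => by rw [map_smul, h₁ v hv], fun p hp => by rw [map_smul, h₂ p hp]⟩

/-- The state `|0⟩_L = ∏_v A(v) ⊗_E |0⟩`. -/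
def zeroL (d m n : ℕ) [NeZero d] : Hilb d m n :=
  (vertices m n).noncommProd projA (fun v _ w _ _ => projA_comm v w) (ket 0)

/-- The state `∏_p B(p) ⊗_E ∑_i |i⟩`. -/
def plusL (d m n : ℕ) [NeZero d] : Hilb d m n :=
  (faces m n).noncommProd projB (fun p _ p' _ _ => projB_comm p p') (∑ x, ket x)

/-- A string that passes between faces from `p`, by crossing edges one after the other. -/
inductive XString (p : Face m n) : Face m n → Type
  | nil : XString p p
  | crossRight (e : Edge m n) (ξ : XString p e.left) : XString p e.right
  | crossLeft (e : Edge m n) (ξ : XString p e.right) : XString p e.left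

/-- The `X`-type string operator: `X^i` or its adjoint `X^(-i)` for each crossed edge. -/
def XString.op (i : ZMod d) {p p' : Face m n} : XString p p' → Module.End ℂ (Hilb d m n)
  | .nil => 1
  | .crossRight e ξ => shiftOp (Pi.single e i) * ξ.op i
  | .crossLeft e ξ => shiftOp (Pi.single e (-i)) * ξ.op i

/-- A string that passes between sites from `v`, by running along edges one after the other. -/
inductive ZString (v : Site m n) : Site m n → Type
  | nil : ZString v v
  | along (e : Edge m n) (ξ : ZString v e.src) : ZString v e.tgt
  | against (e : Edge m n) (ξ : ZString v e.tgt) : ZString v e.src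

/-- The sum of the labels along a string, with a sign for each edge that is run through against its
direction. -/
def ZString.sum (x : Config d m n) {v v' : Site m n} : ZString v v' → ZMod d
  | .nil => 0
  | .along e ξ => ξ.sum x + x e
  | .against e ξ => ξ.sum x - x e

/-- The `Z`-type string operator labelled by `δ_j`. -/
def ZString.op (j : ZMod d) {v v' : Site m n} (ξ : ZString v v') : Module.End ℂ (Hilb d m n) :=
  diagOp fun x => if ξ.sum x = j then 1 else 0

/-- The primitive root of unity `q = exp (2πi/d)`. -/
def q (d : ℕ) : ℂ := Complex.exp (2 * Real.pi * Complex.I / d)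

/-- The `Z`-type string operator in the quasiparticle basis, `∑_j q^(ij) F^(δ_j)`. -/
def ZString.qop (i : ZMod d) {v v' : Site m n} (ξ : ZString v v') : Module.End ℂ (Hilb d m n) :=
  ∑ j : ZMod d, q d ^ (i.val * j.val) • ξ.op j

/-- A string from the left boundary to the right boundary. -/
abbrev LeftRight (m n : ℕ) (s t : Fin (n + 1)) : Type :=
  XString ((0, s) : Face m n) (Fin.last (m + 1), t)

/-- A string from the top boundary to the bottom boundary. -/
abbrev TopBottom (m n : ℕ) (a b : Fin (m + 1)) : Type :=
  ZString ((a, Fin.last (n + 1)) : Site m n) (b, 0)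

theorem nonempty_leftRight (s : Fin (n + 1)) : Nonempty (LeftRight m n s s) := by
  have h : ∀ c : Fin (m + 2), Nonempty (XString ((0, s) : Face m n) (c, s)) :=
    Fin.induction ⟨.nil⟩ fun c ⟨ξ⟩ => ⟨.crossRight (.vert c s) ξ⟩
  exact h _

theorem nonempty_topBottom (a : Fin (m + 1)) : Nonempty (TopBottom m n a a) := by
  have h : ∀ r : Fin (n + 2), Nonempty (ZString ((a, Fin.last (n + 1)) : Site m n) (a, r)) :=
    Fin.reverseInduction ⟨.nil⟩ fun r ⟨ξ⟩ => ⟨.against (.vert a r) ξ⟩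
  exact h _

/-- The state `|i⟩_L`, the `X`-type string operator with label `i` applied to `|0⟩_L`. -/
def ketL {s t : Fin (n + 1)} (ξ : LeftRight m n s t) (i : ZMod d) : Hilb d m n :=
  ξ.op i (zeroL d m n)

/-- The state `|δ_i⟩_L`, the `Z`-type string operator with label `i` in the quasiparticle basis
applied to `|δ_0⟩_L = ∑_k |k⟩_L`. -/
def deltaL {s t : Fin (n + 1)} {a b : Fin (m + 1)} (ξ : LeftRight m n s t)
    (ξ' : TopBottom m n a b) (i : ZMod d) : Hilb d m n :=
  ξ'.qop i (∑ k : ZMod d, ketL ξ k)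

end

end SurfaceCode

open SurfaceCode

/-!
The proof describes all states through the classical configurations `x : Edge m n → ZMod d`.

A configuration `x` is called flat if its flux through every face of `P` vanishes. Summing the
labels upwards in every column, with a minus sign, then yields a potential on the sites whose
gradient is `x`, which is `0` along the bottom boundary and constant along the top boundary
(`exists_grad_eq`); conversely such gradients are flat (`grad_mem_flat`). The bottom value minus the
top value is the holonomy of `x`. Since a potential is determined by its gradient and its
values on the bottom row, there are `d ^ |V|` flat configurations of each holonomy
(`card_flat_holonomy`).

A state is in the vacuum space if and only if it is supported on flat configurations and invariant
under shifts by flat configurations of holonomy `0` (`mem_vac_iff`), because these are the products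
of the shifts at single vertices. Hence a vacuum state is determined by one amplitude for each
holonomy, and the normalised indicator functions `sector d m n i` of the flat configurations of
holonomy `i` are an orthogonal basis.

A left-right string shifts by a flat configuration: each crossing moves flux from one face to the
next, and both end faces carry no stabiliser. Its holonomy is the label of the string, as the
holonomy counts how often the string leaves the squares outside the left boundary. Therefore
`|i⟩_L` is the sector state of holonomy `i`, whatever the string (`ketL_eq_sector`). For `i = 0`
this is `zeroL_eq_sector`: the vertex projectors keep the holonomy and the sum of all amplitudes. On
the gradient of a potential the sum along a top-bottom string telescopes to minus the holonomy
(`topBottom_sum`), so the `Z`-type string operators act on sector states by characters of `ZMod d`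
(`qop_sector`), and all assertions on the states `|δ_i⟩_L` follow from the orthogonality of
characters. The face projectors cut `⊗_E ∑_i |i⟩ = ∑_x |x⟩` down to the flat configurations, which
is a multiple of the sum of the sector states (`plusL_eq`).
-/

namespace SurfaceCode

noncomputable section

variable {d m n : ℕ}

/-! ### Flat configurations and gradients -/

/-- The edges are the vertical ones together with the horizontal ones. -/
def edgeEquiv (m n : ℕ) : (Fin (m + 1) × Fin (n + 1)) ⊕ (Fin m × Fin n) ≃ Edge m n where
  toFun := Sum.elim (fun a => .vert a.1 a.2) fun a => .horiz a.1 a.2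
  invFun
    | .vert c s => .inl (c, s)
    | .horiz c r => .inr (c, r)
  left_inv := by rintro (_ | _) <;> rfl
  right_inv := by rintro (_ | _) <;> rfl

theorem sum_edge {M : Type*} [AddCommMonoid M] (f : Edge m n → M) :
    ∑ e, f e = (∑ c, ∑ s, f (.vert c s)) + ∑ c, ∑ r, f (.horiz c r) := by
  rw [← (edgeEquiv m n).sum_comp, Fintype.sum_sum_type, Fintype.sum_prod_type,
    Fintype.sum_prod_type]
  rfl

/-- The label of the rightward edge that starts in column `c` and row `r`, extended by `0` to the
top and bottom rows, which have no such edges. -/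
def rowLabel (x : Config d m n) (c : Fin m) : Fin (n + 2) → ZMod d :=
  Fin.cases 0 (Fin.lastCases 0 fun r => x (.horiz c r))

@[simp] theorem rowLabel_zero (x : Config d m n) (c : Fin m) : rowLabel x c 0 = 0 := rfl

@[simp] theorem rowLabel_last (x : Config d m n) (c : Fin m) :
    rowLabel x c (Fin.last (n + 1)) = 0 := by
  rw [← Fin.succ_last]
  simp only [rowLabel, Fin.cases_succ, Fin.lastCases_last]

@[simp] theorem rowLabel_succ (x : Config d m n) (c : Fin m) (r : Fin n) :
    rowLabel x c r.castSucc.succ = x (.horiz c r) := by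
  simp only [rowLabel, Fin.cases_succ, Fin.lastCases_castSucc]

theorem sum_horiz_above (x : Config d m n) (c : Fin m) (s : Fin (n + 1)) :
    (∑ r : Fin n, if r.castSucc = s then x (.horiz c r) else 0) = rowLabel x c s.succ := by
  induction s using Fin.lastCases with
  | last =>
    rw [Fin.succ_last, rowLabel_last]
    exact Finset.sum_eq_zero fun r _ => if_neg (Fin.castSucc_ne_last r)
  | cast s => simp [Fin.castSucc_inj]

theorem sum_horiz_below (x : Config d m n) (c : Fin m) (s : Fin (n + 1)) :
    (∑ r : Fin n, if r.succ = s then x (.horiz c r) else 0) = rowLabel x c s.castSucc := by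
  induction s using Fin.cases with
  | zero =>
    rw [Fin.castSucc_zero, rowLabel_zero]
    exact Finset.sum_eq_zero fun r _ => if_neg (Fin.succ_ne_zero r)
  | succ s => rw [← Fin.succ_castSucc]; simp

/-- The flux through an interior face, in terms of its four sides. -/
theorem flux_interior (x : Config d m n) (c : Fin m) (s : Fin (n + 1)) :
    flux (c.castSucc.succ, s) x =
      x (.vert c.castSucc s) - x (.vert c.succ s) +
        (rowLabel x c s.succ - rowLabel x c s.castSucc) := by
  have h₁ : ∀ c' : Fin (m + 1), (c'.succ = c.castSucc.succ) ↔ c' = c.castSucc := fun c' =>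
    Fin.succ_inj
  have h₂ : ∀ c' : Fin (m + 1), (c'.castSucc = c.castSucc.succ) ↔ c' = c.succ := fun c' => by
    rw [Fin.succ_castSucc, Fin.castSucc_inj]
  rw [flux, sum_edge, ← sum_horiz_above, ← sum_horiz_below]
  simp only [Edge.left, Edge.right, Prod.mk.injEq, h₁, h₂, Fin.castSucc_inj, ite_and,
    Finset.sum_sub_distrib, Finset.sum_ite_irrel, Finset.sum_ite_eq', Finset.mem_univ, if_true,
    Finset.sum_const_zero]

theorem not_two_le_card_filter {α : Type*} [Fintype α] {P : α → Prop} [DecidablePred P] {a : α}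
    (h : ∀ b, P b → b = a) : ¬ 2 ≤ (Finset.univ.filter P).card := by
  refine not_le.2 (Nat.lt_succ_of_le (Finset.card_le_one.2 fun b hb c hc => ?_))
  rw [h b (Finset.mem_filter.1 hb).2, h c (Finset.mem_filter.1 hc).2]

/-- The faces with a stabiliser are those between the left and the right boundary. -/
theorem mem_faces {p : Face m n} : p ∈ faces m n ↔ ∃ (c : Fin m) (s : Fin (n + 1)),
    p = (c.castSucc.succ, s) := by
  obtain ⟨c, s⟩ := p
  simp only [faces, Finset.mem_filter, Finset.mem_univ, true_and]
  constructor
  · intro h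
    induction c using Fin.cases with
    | zero =>
      refine absurd h (not_two_le_card_filter (a := .vert 0 s) ?_)
      rintro (⟨c, s'⟩ | ⟨c, r⟩) he <;>
        simp only [Edge.left, Edge.right, Prod.mk.injEq, Fin.ext_iff, Fin.val_succ,
          Fin.val_castSucc, Fin.coe_ofNat_eq_mod, Nat.zero_mod, Edge.vert.injEq, reduceCtorEq] at he ⊢ <;> tauto
    | succ c =>
      induction c using Fin.lastCases with
      | last =>
        refine absurd h (not_two_le_card_filter (a := .vert (Fin.last m) s) ?_)
        rintro (⟨c, s'⟩ | ⟨c, r⟩) he <;>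
          simp only [Edge.left, Edge.right, Prod.mk.injEq, Fin.ext_iff, Fin.val_succ,
            Fin.val_castSucc, Fin.val_last, Edge.vert.injEq, reduceCtorEq] at he ⊢ <;> omega
      | cast c => exact ⟨c, s, rfl⟩
  · rintro ⟨c, s, h⟩
    rw [h]
    refine Finset.one_lt_card.2 ⟨.vert c.castSucc s,
      Finset.mem_filter.2 ⟨Finset.mem_univ _, .inr rfl⟩,
      .vert c.succ s, Finset.mem_filter.2 ⟨Finset.mem_univ _, .inl rfl⟩, ?_⟩
    simp [Fin.ext_iff]

/-- The vertices with a stabiliser are those that are not the end of a dangling edge. -/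
theorem mem_vertices {v : Site m n} : v ∈ vertices m n ↔ v.2 ≠ 0 ∧ v.2 ≠ Fin.last (n + 1) := by
  obtain ⟨c, r⟩ := v
  simp only [vertices, Finset.mem_filter, Finset.mem_univ, true_and]
  constructor
  · refine fun h => ⟨?_, ?_⟩ <;> rintro rfl
    · refine absurd h (not_two_le_card_filter (a := .vert c 0) ?_)
      rintro (⟨c', s'⟩ | ⟨c', r⟩) he <;>
        simp only [Edge.src, Edge.tgt, Prod.mk.injEq, Fin.ext_iff, Fin.val_succ, Fin.val_castSucc,
          Fin.coe_ofNat_eq_mod, Nat.zero_mod, Edge.vert.injEq, reduceCtorEq] at he ⊢ <;> tauto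
    · refine absurd h (not_two_le_card_filter (a := .vert c (Fin.last n)) ?_)
      rintro (⟨c', s'⟩ | ⟨c', r⟩) he <;>
        simp only [Edge.src, Edge.tgt, Prod.mk.injEq, Fin.ext_iff, Fin.val_succ, Fin.val_castSucc,
          Fin.val_last, Edge.vert.injEq, reduceCtorEq] at he ⊢ <;> omega
  · rintro ⟨h₀, h₁⟩
    obtain ⟨s, rfl⟩ := Fin.exists_succ_eq.2 h₀
    obtain ⟨t, ht⟩ := Fin.exists_castSucc_eq.2 h₁
    refine Finset.one_lt_card.2 ⟨.vert c s, Finset.mem_filter.2 ⟨Finset.mem_univ _, .inr rfl⟩,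
      .vert c t, Finset.mem_filter.2 ⟨Finset.mem_univ _, .inl (congrArg (Prod.mk c) ht)⟩, ?_⟩
    have := congrArg Fin.val ht
    simp only [Fin.val_succ, Fin.val_castSucc] at this
    simp only [ne_eq, Edge.vert.injEq, true_and, Fin.ext_iff]
    omega

theorem flux_add (p : Face m n) (x y : Config d m n) : flux p (x + y) = flux p x + flux p y := by
  simp only [flux, ← Finset.sum_add_distrib]
  refine Finset.sum_congr rfl fun e _ => ?_
  simp only [Pi.add_apply]
  split_ifs <;> ring

/-- The flux through a face as a homomorphism. -/
def fluxHom (p : Face m n) : Config d m n →+ ZMod d := AddMonoidHom.mk' (flux p) (flux_add p)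

variable (d m n) in
/-- The configurations without flux through the faces that carry a stabiliser. -/
def flat : AddSubgroup (Config d m n) := ⨅ p ∈ faces m n, (fluxHom p).ker

theorem mem_flat {x : Config d m n} : x ∈ flat d m n ↔ ∀ p ∈ faces m n, flux p x = 0 := by
  simp [flat, AddSubgroup.mem_iInf, fluxHom]

variable (d m n) in
/-- The sum of the labels along the leftmost column of upward edges. For a flat configuration it
decides which of the logical basis states contains it. -/
def holonomy : Config d m n →+ ZMod d where
  toFun x := ∑ s, x (.vert 0 s)
  map_zero' := by simp
  map_add' _ _ := by simp [Finset.sum_add_distrib]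

/-- The gradient of a function on the sites. -/
def grad : (Site m n → ZMod d) →+ Config d m n where
  toFun h e := h e.src - h e.tgt
  map_zero' := by ext; simp
  map_add' _ _ := by ext; simp; ring

theorem grad_apply (h : Site m n → ZMod d) (e : Edge m n) : grad h e = h e.src - h e.tgt := rfl

theorem holonomy_grad (h : Site m n → ZMod d) :
    holonomy d m n (grad h) = h (0, 0) - h (0, Fin.last (n + 1)) := by
  change ∑ s : Fin (n + 1), (h (0, s.castSucc) - h (0, s.succ)) = _
  have h₁ := Fin.sum_univ_succ fun r : Fin (n + 2) => h (0, r)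
  have h₂ := Fin.sum_univ_castSucc fun r : Fin (n + 2) => h (0, r)
  rw [Finset.sum_sub_distrib]
  linear_combination h₂.symm.trans h₁

/-- A gradient is flat as soon as the potential is constant on the two rough boundaries, where
there are no edges that would cancel the flux through the adjacent faces. -/
theorem grad_mem_flat {h : Site m n → ZMod d} {a b : ZMod d} (h₀ : ∀ c, h (c, 0) = a)
    (h₁ : ∀ c, h (c, Fin.last (n + 1)) = b) : grad h ∈ flat d m n := by
  have key : ∀ (c : Fin m) (r : Fin (n + 2)),
      rowLabel (grad h) c r = h (c.castSucc, r) - h (c.succ, r) := by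
    intro c r
    induction r using Fin.cases with
    | zero => simp [h₀]
    | succ r =>
      induction r using Fin.lastCases with
      | last => simp [h₁]
      | cast r => rw [rowLabel_succ]; rfl
  rw [mem_flat]
  intro p hp
  obtain ⟨c, s, rfl⟩ := mem_faces.1 hp
  rw [flux_interior, key, key]
  simp only [grad_apply, Edge.src, Edge.tgt]
  ring

/-- A potential concentrated at a vertex that carries a stabiliser vanishes on both rough
boundaries. -/
theorem single_rough {v : Site m n} (hv : v ∈ vertices m n) (l : ZMod d) (c : Fin (m + 1)) :
    (Pi.single v l : Site m n → ZMod d) (c, 0) = 0 ∧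
      (Pi.single v l : Site m n → ZMod d) (c, Fin.last (n + 1)) = 0 := by
  obtain ⟨h₀, h₁⟩ := mem_vertices.1 hv
  exact ⟨Pi.single_eq_of_ne (fun h => h₀ (congrArg Prod.snd h).symm) _,
    Pi.single_eq_of_ne (fun h => h₁ (congrArg Prod.snd h).symm) _⟩

theorem grad_single_mem_flat {v : Site m n} (hv : v ∈ vertices m n) (l : ZMod d) :
    grad (Pi.single v l) ∈ flat d m n :=
  grad_mem_flat (fun c => (single_rough hv l c).1) fun c => (single_rough hv l c).2

theorem holonomy_grad_single {v : Site m n} (hv : v ∈ vertices m n) (l : ZMod d) :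
    holonomy d m n (grad (Pi.single v l)) = 0 := by
  rw [holonomy_grad, (single_rough hv l 0).1, (single_rough hv l 0).2, sub_zero]

theorem partialSum_last {k : ℕ} (f : Fin k → ZMod d) :
    Fin.partialSum f (Fin.last k) = ∑ i, f i := by
  simp [Fin.partialSum, List.sum_ofFn, List.take_of_length_le]

/-- A flat configuration is the gradient of the potential that is obtained by summing the negated
labels upwards in every column. -/
theorem exists_grad_eq {x : Config d m n} (hx : x ∈ flat d m n) : ∃ h : Site m n → ZMod d,
    (∀ c, h (c, 0) = 0) ∧ (∀ c, h (c, Fin.last (n + 1)) = -holonomy d m n x) ∧ grad h = x := by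
  let h : Site m n → ZMod d := fun v => -Fin.partialSum (fun s => x (.vert v.1 s)) v.2
  have vert : ∀ c s, h (c, s.castSucc) - h (c, s.succ) = x (.vert c s) := by
    intro c s
    simp only [h, Fin.partialSum_succ]
    ring
  have horiz : ∀ (c : Fin m) (r : Fin (n + 2)),
      h (c.castSucc, r) - h (c.succ, r) = rowLabel x c r := by
    intro c r
    induction r using Fin.induction with
    | zero => simp [h]
    | succ s ih =>
      have := mem_flat.1 hx _ (mem_faces.2 ⟨c, s, rfl⟩)
      rw [flux_interior, ← vert, ← vert, ← ih] at this
      linear_combination -this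
  refine ⟨h, fun c => by simp [h], fun c => ?_, ?_⟩
  · induction c using Fin.induction with
    | zero => simp only [h, partialSum_last]; rfl
    | succ c ih =>
      have := horiz c (Fin.last _)
      rw [rowLabel_last] at this
      rw [← ih]
      linear_combination -this
  · ext e
    cases e with
    | vert c s => exact vert c s
    | horiz c r => exact (horiz c _).trans (rowLabel_succ x c r)

/-- A potential is determined by its gradient and its values on the bottom row. -/
theorem grad_injOn {h h' : Site m n → ZMod d} (h₀ : ∀ c, h (c, 0) = h' (c, 0))
    (hg : grad h = grad h') : h = h' := by
  ext ⟨c, r⟩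
  induction r using Fin.induction with
  | zero => exact h₀ c
  | succ s ih =>
    have := congrFun hg (.vert c s)
    simp only [grad_apply, Edge.src, Edge.tgt, ih] at this
    linear_combination -this

/-- The potential with the given values in the rows that carry stabilisers, with `0` at the bottom
and `-i` at the top. -/
def extend (i : ZMod d) (g : Fin (m + 1) × Fin n → ZMod d) : Site m n → ZMod d := fun v =>
  Fin.cases 0 (Fin.lastCases (-i) fun r => g (v.1, r)) v.2

theorem extend_zero (i : ZMod d) (g : Fin (m + 1) × Fin n → ZMod d) (c : Fin (m + 1)) :
    extend i g (c, 0) = 0 := rfl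

theorem extend_last (i : ZMod d) (g : Fin (m + 1) × Fin n → ZMod d) (c : Fin (m + 1)) :
    extend i g (c, Fin.last (n + 1)) = -i := by
  rw [← Fin.succ_last]
  simp only [extend, Fin.cases_succ, Fin.lastCases_last]

theorem extend_succ (i : ZMod d) (g : Fin (m + 1) × Fin n → ZMod d) (c : Fin (m + 1))
    (r : Fin n) : extend i g (c, r.castSucc.succ) = g (c, r) := by
  simp only [extend, Fin.cases_succ, Fin.lastCases_castSucc]

open Classical in
/-- There are `d ^ |V|` flat configurations of each holonomy: they are the gradients of the
potentials with prescribed values on the rough boundaries. -/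
theorem card_flat_holonomy [NeZero d] (i : ZMod d) :
    (Finset.univ.filter fun x : Config d m n => x ∈ flat d m n ∧ holonomy d m n x = i).card =
      d ^ ((m + 1) * n) := by
  have him : (Finset.univ.filter fun x : Config d m n => x ∈ flat d m n ∧ holonomy d m n x = i) =
      Finset.univ.image fun g => grad (extend i g) := by
    ext x
    simp only [Finset.mem_filter, Finset.mem_univ, true_and, Finset.mem_image]
    constructor
    · rintro ⟨hx, rfl⟩
      obtain ⟨h, h₀, h₁, rfl⟩ := exists_grad_eq hx
      refine ⟨fun a => h (a.1, a.2.castSucc.succ), congrArg _ ?_⟩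
      ext ⟨c, r⟩
      induction r using Fin.cases with
      | zero => rw [extend_zero, h₀]
      | succ r =>
        induction r using Fin.lastCases with
        | last => rw [Fin.succ_last, extend_last, h₁]
        | cast r => rw [extend_succ]
    · rintro ⟨g, rfl⟩
      refine ⟨grad_mem_flat (extend_zero i g) (extend_last i g), ?_⟩
      rw [holonomy_grad, extend_zero, extend_last, sub_neg_eq_add, zero_add]
  rw [him, Finset.card_image_of_injective]
  · simp [ZMod.card]
  · intro g g' hg
    have := grad_injOn (h := extend i g) (h' := extend i g') (fun c => rfl) hg
    ext ⟨c, r⟩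
    simpa only [extend_succ] using congrFun this (c, r.castSucc.succ)

/-! ### Strings -/

/-- The configuration by which the `X`-type string operator with label `i` shifts. -/
def XString.config (i : ZMod d) {p p' : Face m n} : XString p p' → Config d m n
  | .nil => 0
  | .crossRight e ξ => Pi.single e i + ξ.config i
  | .crossLeft e ξ => Pi.single e (-i) + ξ.config i

/-- Each crossing moves flux `i` from one face to the next. -/
theorem XString.flux_config (i : ZMod d) {p p' : Face m n} (ξ : XString p p') (r : Face m n) :
    flux r (ξ.config i) = (if p' = r then i else 0) - if p = r then i else 0 := by
  have single : ∀ (e : Edge m n) (j : ZMod d), flux r (Pi.single e j) =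
      (if e.right = r then j else 0) - if e.left = r then j else 0 := by
    intro e j
    rw [flux, Finset.sum_eq_single e]
    · simp
    · intro f _ hf
      simp [Pi.single_eq_of_ne hf]
    · simp
  induction ξ with
  | nil => rw [XString.config, sub_self]; exact (fluxHom r).map_zero
  | crossRight e ξ ih => rw [XString.config, flux_add, ih, single]; ring
  | crossLeft e ξ ih =>
    rw [XString.config, flux_add, ih, single]
    split_ifs <;> ring

/-- The holonomy counts how often a string leaves the squares outside the left boundary. -/
theorem XString.holonomy_config (i : ZMod d) {p p' : Face m n} (ξ : XString p p') :
    holonomy d m n (ξ.config i) = (if p.1 = 0 then i else 0) - if p'.1 = 0 then i else 0 := by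
  have single : ∀ (e : Edge m n) (j : ZMod d), holonomy d m n (Pi.single e j) =
      (if e.left.1 = 0 then j else 0) - if e.right.1 = 0 then j else 0 := by
    intro e j
    change ∑ s, (Pi.single e j : Config d m n) (.vert 0 s) = _
    cases e with
    | vert c s =>
      by_cases hc : c = 0
      · subst hc
        simp [Edge.left, Edge.right, Pi.single_apply]
      · have hc' : c.castSucc ≠ 0 := fun h => hc (by simpa using h)
        simp [Edge.left, Edge.right, hc', Ne.symm hc]
    | horiz c r => simp [Edge.left, Edge.right]
  induction ξ with
  | nil => rw [XString.config, map_zero, sub_self]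
  | crossRight e ξ ih => rw [XString.config, map_add, ih, single]; ring
  | crossLeft e ξ ih =>
    rw [XString.config, map_add, ih, single]
    split_ifs <;> ring

theorem config_mem_flat (i : ZMod d) {s t : Fin (n + 1)} (ξ : LeftRight m n s t) :
    ξ.config i ∈ flat d m n := by
  rw [mem_flat]
  intro p hp
  obtain ⟨c, s, rfl⟩ := mem_faces.1 hp
  rw [ξ.flux_config, if_neg, if_neg, sub_self]
  · simp [Fin.ext_iff]
  · simp [Fin.ext_iff]; omega

theorem holonomy_config (i : ZMod d) {s t : Fin (n + 1)} (ξ : LeftRight m n s t) :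
    holonomy d m n (ξ.config i) = i := by
  rw [ξ.holonomy_config, if_pos rfl, if_neg (Fin.last_pos.ne'), sub_zero]

theorem ZString.sum_grad (h : Site m n → ZMod d) {v v' : Site m n} (ξ : ZString v v') :
    ξ.sum (grad h) = h v - h v' := by
  induction ξ with
  | nil => simp [ZString.sum]
  | along e ξ ih => rw [ZString.sum, ih, grad_apply]; ring
  | against e ξ ih => rw [ZString.sum, ih, grad_apply]; ring

/-- On flat configurations the sum along a string from top to bottom depends only on the
holonomy. -/
theorem topBottom_sum {x : Config d m n} (hx : x ∈ flat d m n) {a b : Fin (m + 1)}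
    (ξ : TopBottom m n a b) : ξ.sum x = -holonomy d m n x := by
  obtain ⟨h, h₀, h₁, hg⟩ := exists_grad_eq hx
  conv_lhs => rw [← hg]
  rw [ξ.sum_grad, h₀, h₁, sub_zero]

/-! ### String operators -/

variable [NeZero d]

theorem shiftOp_zero : shiftOp (0 : Config d m n) = 1 := by
  refine LinearMap.ext fun ψ => ?_
  ext x
  change ψ (x - 0) = ψ x
  rw [sub_zero]

theorem shiftOp_mul (a b : Config d m n) : shiftOp a * shiftOp b = shiftOp (a + b) := by
  refine LinearMap.ext fun ψ => ?_
  ext x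
  change ψ (x - a - b) = ψ (x - (a + b))
  rw [sub_sub]

theorem XString.op_eq (i : ZMod d) {p p' : Face m n} (ξ : XString p p') :
    ξ.op i = shiftOp (ξ.config i) := by
  induction ξ with
  | nil => exact shiftOp_zero.symm
  | crossRight e ξ ih => rw [XString.op, ih, shiftOp_mul]; rfl
  | crossLeft e ξ ih => rw [XString.op, ih, shiftOp_mul]; rfl

/-! ### Stabiliser projectors -/

theorem shiftOp_apply (a : Config d m n) (ψ : Hilb d m n) (x : Config d m n) :
    shiftOp a ψ x = ψ (x - a) := rfl

theorem vertexAct_eq (l : ZMod d) (v : Site m n) :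
    vertexAct l v = shiftOp (grad (Pi.single v l)) := by
  refine congrArg shiftOp (funext fun e => ?_)
  rw [grad_apply, Pi.single_apply, Pi.single_apply]

theorem vertexAct_mul_projA (l : ZMod d) (v : Site m n) :
    vertexAct l v * projA v = (projA v : Module.End ℂ (Hilb d m n)) := by
  rw [projA, mul_smul_comm, Finset.mul_sum]
  congr 1
  refine Fintype.sum_equiv (Equiv.addLeft l) _ _ fun k => ?_
  rw [vertexAct_eq, vertexAct_eq, vertexAct_eq, shiftOp_mul, ← map_add, ← Pi.single_add]
  rfl

theorem projA_eq_self_iff {v : Site m n} {ψ : Hilb d m n} :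
    projA v ψ = ψ ↔ ∀ l : ZMod d, vertexAct l v ψ = ψ := by
  constructor
  · intro h l
    rw [← h, ← Module.End.mul_apply, vertexAct_mul_projA]
  · intro h
    have hd : (d : ℂ) ≠ 0 := Nat.cast_ne_zero.2 (NeZero.ne d)
    simp only [projA, LinearMap.smul_apply, LinearMap.sum_apply, h, Finset.sum_const,
      Finset.card_univ, ZMod.card, ← Nat.cast_smul_eq_nsmul ℂ, smul_smul]
    rw [one_div, inv_mul_cancel₀ hd, one_smul]

theorem projA_mul_self (v : Site m n) :
    projA v * projA v = (projA v : Module.End ℂ (Hilb d m n)) :=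
  LinearMap.ext fun ψ => projA_eq_self_iff.2 fun l => by
    rw [← Module.End.mul_apply, vertexAct_mul_projA]

theorem projB_apply (p : Face m n) (ψ : Hilb d m n) (x : Config d m n) :
    projB p ψ x = (if flux p x = 0 then 1 else 0) * ψ x := rfl

theorem projB_mul_self (p : Face m n) :
    projB p * projB p = (projB p : Module.End ℂ (Hilb d m n)) := by
  refine LinearMap.ext fun ψ => ?_
  ext x
  rw [Module.End.mul_apply, projB_apply, projB_apply]
  split_ifs <;> simp

theorem mul_noncommProd_of_idempotent {α R : Type*} [Monoid R] {s : Finset α} {f : α → R}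
    (comm : ∀ a ∈ s, ∀ b ∈ s, a ≠ b → Commute (f a) (f b)) {a : α} (ha : a ∈ s)
    (h : f a * f a = f a) : f a * s.noncommProd f comm = s.noncommProd f comm := by
  classical
  rw [← Finset.mul_noncommProd_erase s ha f comm, ← mul_assoc, h]

/-- A vector belongs to the vacuum space if and only if it is supported on flat configurations and
invariant under the gradients of the potentials that vanish on the rough boundaries. -/
theorem mem_vac_iff {ψ : Hilb d m n} : ψ ∈ vac d m n ↔
    (∀ x ∉ flat d m n, ψ x = 0) ∧ ∀ a ∈ flat d m n, holonomy d m n a = 0 → shiftOp a ψ = ψ := by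
  change ((∀ v ∈ vertices m n, projA v ψ = ψ) ∧ ∀ p ∈ faces m n, projB p ψ = ψ) ↔ _
  constructor
  · rintro ⟨hA, hB⟩
    constructor
    · intro x hx
      rw [mem_flat] at hx
      push Not at hx
      obtain ⟨p, hp, hpx⟩ := hx
      rw [← hB p hp, projB_apply, if_neg hpx, zero_mul]
    · intro a ha ha'
      obtain ⟨h, h₀, h₁, rfl⟩ := exists_grad_eq ha
      rw [← Finset.univ_sum_single h, map_sum]
      refine Finset.sum_induction _ (fun a => shiftOp a ψ = ψ) (fun a b ha hb => ?_) ?_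
        fun v _ => ?_
      · rw [← shiftOp_mul, Module.End.mul_apply, hb, ha]
      · rw [shiftOp_zero, Module.End.one_apply]
      · by_cases hv : v ∈ vertices m n
        · rw [← vertexAct_eq]
          exact projA_eq_self_iff.1 (hA v hv) _
        · have : h v = 0 := by
            obtain ⟨c, r⟩ := v
            rw [mem_vertices, not_and_or, not_not, not_not] at hv
            rcases hv with hr | hr
            · rw [show r = 0 from hr, h₀]
            · rw [show r = Fin.last (n + 1) from hr, h₁, ha', neg_zero]
          rw [this, Pi.single_zero, map_zero, shiftOp_zero, Module.End.one_apply]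
  · rintro ⟨hB, hA⟩
    constructor
    · intro v hv
      refine projA_eq_self_iff.2 fun l => ?_
      rw [vertexAct_eq]
      exact hA _ (grad_single_mem_flat hv l) (holonomy_grad_single hv l)
    · intro p hp
      ext x
      rw [projB_apply]
      split_ifs with hx
      · rw [one_mul]
      · rw [zero_mul, hB x fun hf => hx (mem_flat.1 hf p hp)]

/-! ### Sector states -/

open Classical in
/-- The uniform superposition of the flat configurations of holonomy `i`, with amplitudes
`d ^ (-|V|)`. -/
def sector (d m n : ℕ) [NeZero d] (i : ZMod d) : Hilb d m n :=
  WithLp.toLp 2 fun x =>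
    if x ∈ flat d m n ∧ holonomy d m n x = i then 1 / (d : ℂ) ^ ((m + 1) * n) else 0

open Classical in
theorem sector_apply (i : ZMod d) (x : Config d m n) : sector d m n i x =
    if x ∈ flat d m n ∧ holonomy d m n x = i then 1 / (d : ℂ) ^ ((m + 1) * n) else 0 := rfl

theorem shiftOp_sector {a : Config d m n} (ha : a ∈ flat d m n) (i : ZMod d) :
    shiftOp a (sector d m n i) = sector d m n (i + holonomy d m n a) := by
  ext x
  rw [shiftOp_apply, sector_apply, sector_apply]
  congr 1
  rw [map_sub, sub_eq_iff_eq_add, sub_eq_add_neg,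
    AddSubgroup.add_mem_cancel_right _ ((flat d m n).neg_mem ha)]

theorem sector_mem_vac (i : ZMod d) : sector d m n i ∈ vac d m n := by
  refine mem_vac_iff.2 ⟨fun x hx => ?_, fun a ha ha' => ?_⟩
  · rw [sector_apply, if_neg fun h => hx h.1]
  · rw [shiftOp_sector ha, ha', add_zero]

theorem pow_card_ne_zero (d m n : ℕ) [NeZero d] : (d : ℂ) ^ ((m + 1) * n) ≠ 0 :=
  pow_ne_zero _ (Nat.cast_ne_zero.2 (NeZero.ne d))

theorem sum_sector (i : ZMod d) : ∑ x, sector d m n i x = 1 := by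
  classical
  simp only [sector_apply]
  rw [← Finset.sum_filter, Finset.sum_const, card_flat_holonomy, nsmul_eq_mul, Nat.cast_pow,
    mul_one_div_cancel (pow_card_ne_zero d m n)]

theorem inner_sector (i j : ZMod d) : inner ℂ (sector d m n i) (sector d m n j) =
    if i = j then 1 / (d : ℂ) ^ ((m + 1) * n) else 0 := by
  rw [PiLp.inner_apply]
  have : ∀ x, inner ℂ (sector d m n i x) (sector d m n j x) =
      (if i = j then 1 / (d : ℂ) ^ ((m + 1) * n) else 0) * sector d m n i x := by
    intro x
    rw [RCLike.inner_apply]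
    simp only [sector_apply]
    by_cases hi : x ∈ flat d m n ∧ holonomy d m n x = i
    · obtain ⟨hx, rfl⟩ := hi
      simp [hx]
    · simp [hi]
  simp only [this]
  rw [← Finset.mul_sum, sum_sector, mul_one]

open Classical in
/-- A vacuum state is determined by one amplitude for each holonomy. -/
theorem eq_sum_sector {ψ : Hilb d m n} (hψ : ψ ∈ vac d m n) {a : ZMod d → Config d m n}
    (ha : ∀ i, a i ∈ flat d m n) (ha' : ∀ i, holonomy d m n (a i) = i) :
    ψ = ∑ i, ((d : ℂ) ^ ((m + 1) * n) * ψ (a i)) • sector d m n i := by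
  obtain ⟨hB, hA⟩ := mem_vac_iff.1 hψ
  ext x
  simp only [WithLp.ofLp_sum, Finset.sum_apply, WithLp.ofLp_smul, Pi.smul_apply, smul_eq_mul]
  by_cases hx : x ∈ flat d m n
  · rw [Finset.sum_eq_single (holonomy d m n x)]
    · rw [sector_apply, if_pos ⟨hx, rfl⟩, mul_right_comm,
        mul_one_div_cancel (pow_card_ne_zero d m n), one_mul]
      conv_rhs => rw [← hA (a (holonomy d m n x) - x) ((flat d m n).sub_mem (ha _) hx)
        (by rw [map_sub, ha', sub_self]), shiftOp_apply, sub_sub_cancel]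
    · intro i _ hi
      rw [sector_apply, if_neg fun h => hi h.2.symm, mul_zero]
    · simp
  · rw [hB x hx, Finset.sum_eq_zero]
    intro i _
    rw [sector_apply, if_neg fun h => hx h.1, mul_zero]

/-- Every sector contains a configuration: the one by which a string along a row of faces shifts. -/
theorem exists_flat_holonomy (d m n : ℕ) : ∃ a : ZMod d → Config d m n,
    (∀ i, a i ∈ flat d m n) ∧ ∀ i, holonomy d m n (a i) = i := by
  obtain ⟨ξ⟩ := nonempty_leftRight (m := m) (0 : Fin (n + 1))
  exact ⟨fun i => ξ.config i, fun i => config_mem_flat i ξ, fun i => holonomy_config i ξ⟩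

/-- Nonzero pairwise orthogonal states of the vacuum space are linearly independent in it. -/
theorem linearIndependent_vac {f : ZMod d → vac d m n} {c : ℂ} (hc : c ≠ 0)
    (h : ∀ i j, inner ℂ (f i : Hilb d m n) (f j) = if i = j then c else 0) :
    LinearIndependent ℂ f := by
  refine LinearIndependent.of_comp (vac d m n).subtype ?_
  refine linearIndependent_of_ne_zero_of_inner_eq_zero (𝕜 := ℂ) (fun i hi => hc ?_)
    fun i j hij => (h i j).trans (if_neg hij)
  rw [← (h i i).trans (if_pos rfl)]
  exact (congrArg (inner ℂ · _) hi).trans (inner_zero_left _)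

/-- The sector states as a basis of the vacuum space. -/
def sectorBasis (d m n : ℕ) [NeZero d] : Module.Basis (ZMod d) ℂ (vac d m n) :=
  .mk (v := fun i => ⟨sector d m n i, sector_mem_vac i⟩)
    (linearIndependent_vac (one_div_ne_zero (pow_card_ne_zero d m n)) inner_sector) <| by
    rintro ⟨ψ, hψ⟩ -
    obtain ⟨a, ha, ha'⟩ := exists_flat_holonomy d m n
    have : (⟨ψ, hψ⟩ : vac d m n) = ∑ i, ((d : ℂ) ^ ((m + 1) * n) * ψ (a i)) •
        (⟨sector d m n i, sector_mem_vac i⟩ : vac d m n) := by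
      refine Subtype.ext ?_
      push_cast
      exact eq_sum_sector hψ ha ha'
    rw [this]
    exact Submodule.sum_mem _ fun i _ => Submodule.smul_mem _ _ (Submodule.subset_span ⟨i, rfl⟩)

theorem sectorBasis_apply (i : ZMod d) : (sectorBasis d m n i : Hilb d m n) = sector d m n i := by
  rw [sectorBasis, Module.Basis.mk_apply]

theorem finrank_vac (d m n : ℕ) [NeZero d] : Module.finrank ℂ (vac d m n) = d := by
  rw [Module.finrank_eq_card_basis (sectorBasis d m n), ZMod.card]

/-! ### The logical states -/

/-- The vertex projectors only apply shifts by gradients of holonomy `0`, so `|0⟩_L` is supported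
on flat configurations of holonomy `0`. -/
theorem zeroL_support {x : Config d m n} (hx : zeroL d m n x ≠ 0) :
    x ∈ flat d m n ∧ holonomy d m n x = 0 := by
  let S : Set (Hilb d m n) := {ψ | ∀ x, ψ x ≠ 0 → x ∈ flat d m n ∧ holonomy d m n x = 0}
  suffices h : ∀ ψ ∈ S, (vertices m n).noncommProd projA (fun v _ w _ _ => projA_comm v w) ψ ∈ S by
    refine h (ket 0) (fun y hy => ?_) x hx
    obtain rfl : y = 0 := by
      by_contra hne
      exact hy (by simp [ket, hne])
    exact ⟨zero_mem _, map_zero _⟩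
  refine Finset.noncommProd_induction _ _ _
    (fun T : Module.End ℂ (Hilb d m n) => ∀ ψ ∈ S, T ψ ∈ S) (fun T T' h h' ψ hψ => h _ (h' _ hψ))
    (fun ψ hψ => hψ) fun v hv ψ hψ x hx => ?_
  simp only [projA, LinearMap.smul_apply, LinearMap.sum_apply, vertexAct_eq, WithLp.ofLp_smul,
    WithLp.ofLp_sum, Pi.smul_apply, Finset.sum_apply, smul_eq_mul] at hx
  obtain ⟨l, -, hl⟩ := Finset.exists_ne_zero_of_sum_ne_zero (right_ne_zero_of_mul hx)
  obtain ⟨hf, hh⟩ := hψ _ hl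
  rw [sub_eq_add_neg,
    AddSubgroup.add_mem_cancel_right _ ((flat d m n).neg_mem (grad_single_mem_flat hv l))] at hf
  rw [map_sub, holonomy_grad_single hv, sub_zero] at hh
  exact ⟨hf, hh⟩

/-- Every vertex projector preserves the sum of all amplitudes. -/
theorem sum_zeroL (d m n : ℕ) [NeZero d] : ∑ x, zeroL d m n x = 1 := by
  suffices h : ∀ ψ : Hilb d m n, ∑ x, (vertices m n).noncommProd projA
      (fun v _ w _ _ => projA_comm v w) ψ x = ∑ x, ψ x by
    refine (h (ket 0)).trans ?_
    simp [ket]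
  refine Finset.noncommProd_induction _ _ _
    (fun T : Module.End ℂ (Hilb d m n) => ∀ ψ, ∑ x, T ψ x = ∑ x, ψ x)
    (fun T T' h h' ψ => (h _).trans (h' ψ)) (fun ψ => rfl) fun v hv ψ => ?_
  have hd : (d : ℂ) ≠ 0 := Nat.cast_ne_zero.2 (NeZero.ne d)
  have shift : ∀ a : Config d m n, ∑ x, ψ (x - a) = ∑ x, ψ x := fun a =>
    (Equiv.subRight a).sum_comp ψ
  simp only [projA, LinearMap.smul_apply, LinearMap.sum_apply, vertexAct_eq, WithLp.ofLp_smul,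
    WithLp.ofLp_sum, Pi.smul_apply, Finset.sum_apply, smul_eq_mul, shiftOp_apply]
  rw [← Finset.mul_sum, Finset.sum_comm]
  simp only [shift, Finset.sum_const, Finset.card_univ, ZMod.card, nsmul_eq_mul]
  rw [one_div, inv_mul_cancel_left₀ hd]

theorem zeroL_mem_vac (d m n : ℕ) [NeZero d] : zeroL d m n ∈ vac d m n := by
  refine ⟨fun v hv => ?_, fun p hp => ?_⟩
  · have h := mul_noncommProd_of_idempotent
      (fun v _ w _ _ => projA_comm (d := d) (m := m) (n := n) v w) hv (projA_mul_self v)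
    rw [zeroL, ← Module.End.mul_apply, h]
  · ext x
    rw [projB_apply]
    by_cases hx : zeroL d m n x = 0
    · rw [hx, mul_zero]
    · rw [if_pos (mem_flat.1 (zeroL_support hx).1 p hp), one_mul]

theorem zeroL_eq_sector (d m n : ℕ) [NeZero d] : zeroL d m n = sector d m n 0 := by
  obtain ⟨a, ha, ha'⟩ := exists_flat_holonomy d m n
  have h := eq_sum_sector (zeroL_mem_vac d m n) ha ha'
  rw [Finset.sum_eq_single 0] at h
  · -- the normalisation follows by comparison of the sums of all amplitudes
    have hs := sum_zeroL d m n
    rw [h] at hs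
    simp only [WithLp.ofLp_smul, Pi.smul_apply, smul_eq_mul, ← Finset.mul_sum, sum_sector,
      mul_one] at hs
    rw [h, hs, one_smul]
  · intro i _ hi
    have : zeroL d m n (a i) = 0 := by
      by_contra hne
      exact hi ((ha' i).symm.trans (zeroL_support hne).2)
    rw [this, mul_zero, zero_smul]
  · simp

theorem ketL_eq_sector {s t : Fin (n + 1)} (ξ : LeftRight m n s t) (i : ZMod d) :
    ketL ξ i = sector d m n i := by
  rw [ketL, ξ.op_eq, zeroL_eq_sector, shiftOp_sector (config_mem_flat i ξ), holonomy_config,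
    zero_add]

theorem plusL_eq (d m n : ℕ) [NeZero d] :
    plusL d m n = (d : ℂ) ^ ((m + 1) * n) • ∑ k, sector d m n k := by
  ext x
  simp only [WithLp.ofLp_smul, WithLp.ofLp_sum, Pi.smul_apply, Finset.sum_apply, smul_eq_mul]
  by_cases hx : x ∈ flat d m n
  · have h₁ : plusL d m n x = 1 := by
      have h : ∀ ψ : Hilb d m n, (faces m n).noncommProd projB
          (fun p _ p' _ _ => projB_comm p p') ψ x = ψ x := by
        refine Finset.noncommProd_induction _ _ _
          (fun T : Module.End ℂ (Hilb d m n) => ∀ ψ, T ψ x = ψ x)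
          (fun T T' h h' ψ => (h _).trans (h' ψ)) (fun ψ => rfl) fun p hp ψ => ?_
        rw [projB_apply, if_pos (mem_flat.1 hx p hp), one_mul]
      rw [plusL, h]
      simp [ket, Pi.single_apply]
    rw [h₁, Finset.sum_eq_single (holonomy d m n x)]
    · rw [sector_apply, if_pos ⟨hx, rfl⟩, mul_one_div_cancel (pow_card_ne_zero d m n)]
    · intro k _ hk
      rw [sector_apply, if_neg fun h => hk h.2.symm]
    · simp
  · have h₀ : plusL d m n x = 0 := by
      rw [mem_flat] at hx
      push Not at hx
      obtain ⟨p, hp, hpx⟩ := hx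
      have h := mul_noncommProd_of_idempotent
        (fun p _ p' _ _ => projB_comm (d := d) (m := m) (n := n) p p') hp (projB_mul_self p)
      rw [plusL, ← h, Module.End.mul_apply, projB_apply, if_neg hpx, zero_mul]
    rw [h₀, Finset.sum_eq_zero, mul_zero]
    intro k _
    rw [sector_apply, if_neg fun h => hx h.1]

/-! ### The logical Fourier transform -/

theorem q_pow (k : ℕ) : q d ^ k = ZMod.stdAddChar (k : ZMod d) := by
  have := ZMod.stdAddChar_coe (N := d) (k : ℤ)
  rw [Int.cast_natCast] at this
  rw [this, q, ← Complex.exp_nat_mul]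
  congr 1
  push_cast
  ring

theorem q_pow_val (i k : ZMod d) : q d ^ (i.val * k.val) = ZMod.stdAddChar (i * k) := by
  rw [q_pow, Nat.cast_mul, ZMod.natCast_zmod_val, ZMod.natCast_zmod_val]

theorem q_zpow_neg_val (i k : ZMod d) :
    q d ^ (-((i.val * k.val : ℕ) : ℤ)) = ZMod.stdAddChar (-(i * k)) := by
  rw [zpow_neg, zpow_natCast, q_pow_val, AddChar.map_neg_eq_inv]

theorem sum_stdAddChar (k : ZMod d) :
    ∑ i : ZMod d, ZMod.stdAddChar (i * k) = if k = 0 then (d : ℂ) else 0 := by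
  rw [AddChar.sum_mulShift k (ZMod.isPrimitive_stdAddChar d), ZMod.card]
  split_ifs <;> simp

/-- The `Z`-type string operators act on the sector states by characters. -/
theorem qop_sector (i k : ZMod d) {a b : Fin (m + 1)} (ξ : TopBottom m n a b) :
    ξ.qop i (sector d m n k) = (ZMod.stdAddChar (-(i * k)) : ℂ) • sector d m n k := by
  ext x
  have hop : ∀ (j : ZMod d), ξ.op j (sector d m n k) x =
      (if ξ.sum x = j then 1 else 0) * sector d m n k x := fun j => rfl
  simp only [ZString.qop, LinearMap.sum_apply, LinearMap.smul_apply, WithLp.ofLp_sum,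
    WithLp.ofLp_smul, Finset.sum_apply, Pi.smul_apply, smul_eq_mul, hop]
  by_cases hx : x ∈ flat d m n ∧ holonomy d m n x = k
  · simp only [topBottom_sum hx.1, hx.2, ite_mul, one_mul, zero_mul, mul_ite, mul_zero,
      Finset.sum_ite_eq, Finset.mem_univ, if_true]
    rw [q_pow_val, mul_neg]
  · simp only [sector_apply, if_neg hx, mul_zero, Finset.sum_const_zero]

theorem deltaL_eq {s t : Fin (n + 1)} {a b : Fin (m + 1)} (ξ : LeftRight m n s t)
    (ξ' : TopBottom m n a b) (i : ZMod d) :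
    deltaL ξ ξ' i = ∑ k, (ZMod.stdAddChar (-(i * k)) : ℂ) • sector d m n k := by
  simp only [deltaL, ketL_eq_sector, map_sum, qop_sector]

theorem inner_deltaL {s t : Fin (n + 1)} {a b : Fin (m + 1)} (ξ : LeftRight m n s t)
    (ξ' : TopBottom m n a b) (i j : ZMod d) :
    inner ℂ (deltaL ξ ξ' i : Hilb d m n) (deltaL ξ ξ' j) =
      if i = j then (d : ℂ) / (d : ℂ) ^ ((m + 1) * n) else 0 := by
  simp only [deltaL_eq, sum_inner, inner_sum, inner_smul_left, inner_smul_right, inner_sector,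
    mul_ite, mul_zero, Finset.sum_ite_eq', Finset.mem_univ, if_true]
  have : ∀ k : ZMod d, (ZMod.stdAddChar (-(j * k)) : ℂ) *
      ((starRingEnd ℂ) (ZMod.stdAddChar (-(i * k)) : ℂ) * (1 / (d : ℂ) ^ ((m + 1) * n))) =
      ZMod.stdAddChar (k * (i - j)) * (1 / (d : ℂ) ^ ((m + 1) * n)) := by
    intro k
    rw [← AddChar.map_neg_eq_conj, neg_neg, ← mul_assoc, ← AddChar.map_add_eq_mul]
    congr 3
    ring
  simp only [this]
  rw [← Finset.sum_mul, sum_stdAddChar]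
  simp only [sub_eq_zero]
  split_ifs
  · rw [mul_one_div]
  · rw [zero_mul]

theorem deltaL_mem_vac {s t : Fin (n + 1)} {a b : Fin (m + 1)} (ξ : LeftRight m n s t)
    (ξ' : TopBottom m n a b) (i : ZMod d) : (deltaL ξ ξ' i : Hilb d m n) ∈ vac d m n := by
  rw [deltaL_eq]
  exact Submodule.sum_mem _ fun k _ => Submodule.smul_mem _ _ (sector_mem_vac k)

theorem sector_eq_sum_deltaL {s t : Fin (n + 1)} {a b : Fin (m + 1)} (ξ : LeftRight m n s t)
    (ξ' : TopBottom m n a b) (k : ZMod d) : sector d m n k =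
      (1 / (d : ℂ)) • ∑ i : ZMod d, (ZMod.stdAddChar (i * k) : ℂ) • deltaL ξ ξ' i := by
  have hd : (d : ℂ) ≠ 0 := Nat.cast_ne_zero.2 (NeZero.ne d)
  have : ∀ i l : ZMod d, (ZMod.stdAddChar (i * k) : ℂ) * ZMod.stdAddChar (-(i * l)) =
      ZMod.stdAddChar (i * (k - l)) := by
    intro i l
    rw [← AddChar.map_add_eq_mul]
    congr 1
    ring
  simp only [deltaL_eq, Finset.smul_sum, smul_smul]
  rw [Finset.sum_comm]
  simp only [this, ← Finset.sum_smul, ← Finset.mul_sum, sum_stdAddChar, sub_eq_zero,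
    mul_ite, mul_zero, ite_smul, zero_smul, Finset.sum_ite_eq, Finset.mem_univ, if_true]
  rw [one_div, inv_mul_cancel₀ hd, one_smul]

end

end SurfaceCode

open SurfaceCode
theorem mainTheorem1 (d : ℕ) [NeZero d] (hd : 2 ≤ d) (m n : ℕ) :
    -- the vacuum space has dimension `d`
    Module.finrank ℂ (vac d m n) = d ∧
    ∀ {s t : Fin (n + 1)} (ξ : LeftRight m n s t) {a b : Fin (m + 1)} (ξ' : TopBottom m n a b),
      -- `|i⟩_L` does not depend on the string
      (∀ {s₁ t₁ : Fin (n + 1)} (ξ₁ : LeftRight m n s₁ t₁) (i : ZMod d),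
        (ketL ξ₁ i : Hilb d m n) = ketL ξ i) ∧
      -- the two bases of the vacuum space
      (∃ B : Module.Basis (ZMod d) ℂ (vac d m n), ∀ i, (B i : Hilb d m n) = ketL ξ i) ∧
      (∃ D : Module.Basis (ZMod d) ℂ (vac d m n), ∀ i, (D i : Hilb d m n) = deltaL ξ ξ' i) ∧
      -- they are orthogonal, with all vectors of a basis of the same norm
      (∀ i j : ZMod d, inner ℂ (ketL ξ i : Hilb d m n) (ketL ξ j) =
        if i = j then 1 / (d : ℂ) ^ ((m + 1) * n) else 0) ∧
      (∀ i j : ZMod d, inner ℂ (deltaL ξ ξ' i : Hilb d m n) (deltaL ξ ξ' j) =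
        if i = j then (d : ℂ) / (d : ℂ) ^ ((m + 1) * n) else 0) ∧
      -- the logical Fourier transform and its inverse
      (∀ i : ZMod d, deltaL ξ ξ' i =
        ∑ k : ZMod d, q d ^ (-((i.val * k.val : ℕ) : ℤ)) • (ketL ξ k : Hilb d m n)) ∧
      (∀ k : ZMod d, ketL ξ k =
        (1 / (d : ℂ)) • ∑ i : ZMod d, q d ^ (i.val * k.val) • (deltaL ξ ξ' i : Hilb d m n)) ∧
      -- up to normalisation, `|δ_0⟩_L` is the state `∏_p B(p) ⊗_E ∑_i |i⟩`
      plusL d m n = (d : ℂ) ^ ((m + 1) * n) • (deltaL ξ ξ' 0 : Hilb d m n) := by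

  refine ⟨finrank_vac d m n, fun ξ _ _ ξ' => ⟨fun ξ₁ i => ?_, ⟨sectorBasis d m n, fun i => ?_⟩, ?_,
    fun i j => ?_, inner_deltaL ξ ξ', fun i => ?_, fun k => ?_, ?_⟩⟩
  · rw [ketL_eq_sector, ketL_eq_sector]
  · rw [sectorBasis_apply, ketL_eq_sector]
  · have hd₀ : (d : ℂ) ≠ 0 := Nat.cast_ne_zero.2 (NeZero.ne d)
    let f : ZMod d → vac d m n := fun i => ⟨deltaL ξ ξ' i, deltaL_mem_vac ξ ξ' i⟩
    have hf : LinearIndependent ℂ f :=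
      linearIndependent_vac (div_ne_zero hd₀ (pow_card_ne_zero d m n)) (inner_deltaL ξ ξ')
    refine ⟨basisOfLinearIndependentOfCardEqFinrank hf (by rw [ZMod.card, finrank_vac]),
      fun i => ?_⟩
    rw [coe_basisOfLinearIndependentOfCardEqFinrank]
  · rw [ketL_eq_sector, ketL_eq_sector, inner_sector]
  · simp only [ketL_eq_sector, q_zpow_neg_val, deltaL_eq]
  · simp only [q_pow_val]
    rw [ketL_eq_sector]
    exact sector_eq_sum_deltaL ξ ξ' k
  · rw [plusL_eq, deltaL_eq]
    simp only [zero_mul, neg_zero, AddChar.map_zero_eq_one, one_smul]
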